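/- Let $\mathfrak{X}$ be a complex linear space. A (nonnegative sesquilinear) form on $\mathfrak{X}$ is a map $\mathfrak{t}:\mathfrak{X}\times\mathfrak{X}\to\mathbb{C}$ that is linear in its first and antilinear in its second argument, with $\mathfrak{t}[x]:=\mathfrak{t}(x,x)\ge 0$ for all $x\in\mathfrak{X}$. Forms are partially ordered by $\mathfrak{s}\le\mathfrak{t}$ if and only if $\mathfrak{s}[x]\le\mathfrak{t}[x]$ for all $x\in\mathfrak{X}$. For forms $\mathfrak{t},\mathfrak{w}$, the parallel sum $\mathfrak{t}:\mathfrak{w}$ is the form whose quadratic form is $$(\mathfrak{t}:\mathfrak{w})[x]=\inf_{y\in\mathfrak{X}}\big\{\mathfrak{t}[x-y]+\mathfrak{w}[y]\big\},\qquad x\in\mathfrak{X},$$ and $\mathbf{D}_{\mathfrak{w}}\mathfrak{t}:=\sup_{n\in\mathbb{N}}\,\mathfrak{t}:(n\mathfrak{w})$ is the pointwise limit of the increasing sequence $\mathfrak{t}:(n\mathfrak{w})$, which is bounded above by $\mathfrak{t}$. A form $\mathfrak{w}\le\mathfrak{t}$ is called a $\mathfrak{t}$-quasi-unit if $\mathbf{D}_{\mathfrak{w}}\mathfrak{t}=\mathfrak{w}$;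 the set of $\mathfrak{t}$-quasi-units is denoted by $\mathbf{Q}(\mathfrak{t})$. **Corollary.** For every form $\mathfrak{t}$ on $\mathfrak{X}$, the partially ordered set $(\mathbf{Q}(\mathfrak{t}),\le)$ is a lattice. That is, any two $\mathfrak{t}$-quasi-units have a greatest lower bound and a least upper bound in $\mathbf{Q}(\mathfrak{t})$. -/

import Mathlib

/-- A nonnegative sesquilinear form on a complex linear space `X`: linear in the first argument,
antilinear in the second argument, with `0 ≤ t (x, x)` (a real number) for every `x`. -/
@[ext]
structure NonnegForm (X : Type*) [AddCommGroup X] [Module ℂ X] where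
  toLin : X →ₗ[ℂ] X →ₗ⋆[ℂ] ℂ
  re_nonneg : ∀ x, 0 ≤ (toLin x x).re
  im_eq_zero : ∀ x, (toLin x x).im = 0

namespace NonnegForm

variable {X : Type*} [AddCommGroup X] [Module ℂ X]

/-- The quadratic form `t[x] = t (x, x)`. -/
def quad (t : NonnegForm X) (x : X) : ℝ := (t.toLin x x).re

theorem quad_nonneg (t : NonnegForm X) (x : X) : 0 ≤ t.quad x := t.re_nonneg x

theorem toLin_self (t : NonnegForm X) (x : X) : t.toLin x x = (t.quad x : ℂ) :=
  Complex.ext (by simp [quad]) (by simp [t.im_eq_zero])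

/-- The polarization identity. -/
theorem polarization (t : NonnegForm X) (x y : X) :
    t.toLin x y = (1 / 4 : ℂ) * ((t.quad (x + y) : ℂ) - (t.quad (x - y) : ℂ)
      + Complex.I * (t.quad (x + Complex.I • y) : ℂ)
      - Complex.I * (t.quad (x - Complex.I • y) : ℂ)) := by
  simp only [← toLin_self, map_add, map_sub, LinearMap.add_apply, LinearMap.sub_apply,
    LinearMap.map_smulₛₗ, LinearMap.smul_apply, smul_eq_mul, Complex.conj_I, RingHom.id_apply]
  linear_combination ((1 / 2 : ℂ) * t.toLin x y - (1 / 2 : ℂ) * t.toLin y x) * Complex.I_sq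

/-- A form is determined by its quadratic form. -/
theorem ext_quad {s t : NonnegForm X} (h : ∀ x, s.quad x = t.quad x) : s = t := by
  ext x y
  rw [polarization s, polarization t]
  simp only [h]

/-- `s ≤ t` means `s[x] ≤ t[x]` for every `x`. -/
instance : PartialOrder (NonnegForm X) where
  le s t := ∀ x, s.quad x ≤ t.quad x
  le_refl _ _ := le_rfl
  le_trans _ _ _ h₁ h₂ x := (h₁ x).trans (h₂ x)
  le_antisymm _ _ h₁ h₂ := ext_quad fun x => le_antisymm (h₁ x) (h₂ x)

/-- The multiple `n w` of a form by a natural number, defined pointwise. -/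
instance : SMul ℕ (NonnegForm X) where
  smul n w :=
    { toLin := (n : ℂ) • w.toLin
      re_nonneg := fun x => by
        simpa [toLin_self] using mul_nonneg (Nat.cast_nonneg n) (w.quad_nonneg x)
      im_eq_zero := fun x => by simp [toLin_self] }

theorem quad_nsmul (n : ℕ) (w : NonnegForm X) (x : X) : (n • w).quad x = n * w.quad x := by
  change ((n : ℂ) * w.toLin x x).re = _
  simp [toLin_self]

/-- The quotient of a positive semidefinite form by a subspace is again such a form. -/
theorem exists_quad_eq_iInf_norm {E : Type*} [SeminormedAddCommGroup E] [InnerProductSpace ℂ E]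
    (L : X →ₗ[ℂ] E) (K : Submodule ℂ E) :
    ∃ s : NonnegForm X, ∀ x, s.quad x = ⨅ k : K, ‖L x - k‖ ^ 2 := by
  let ι : E →L[ℂ] UniformSpace.Completion E := UniformSpace.Completion.toComplL
  let M : Submodule ℂ (UniformSpace.Completion E) := (K.map ι.toLinearMap).topologicalClosure
  have : CompleteSpace M := (K.map ι.toLinearMap).isClosed_topologicalClosure.completeSpace_coe
  let F : X →ₗ[ℂ] UniformSpace.Completion E :=
    (ContinuousLinearMap.id ℂ _ - M.starProjection).toLinearMap ∘ₗ ι.toLinearMap ∘ₗ L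
  let T : X →ₗ[ℂ] X →ₗ⋆[ℂ] ℂ := LinearMap.mk₂'ₛₗ (RingHom.id ℂ) (starRingEnd ℂ)
    (fun x y => inner ℂ (F y) (F x))
    (fun x x' y => by simp [inner_add_right]) (fun c x y => by simp [inner_smul_right])
    (fun x y y' => by simp [inner_add_left]) (fun c x y => by simp [inner_smul_left])
  have hT : ∀ x, T x x = ((‖F x‖ ^ 2 : ℝ) : ℂ) := fun x => by
    simp [T]
  refine ⟨⟨T, fun x => by rw [hT, Complex.ofReal_re]; positivity,
    fun x => by rw [hT]; exact Complex.ofReal_im _⟩, fun x => ?_⟩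
  have h0 : quad ⟨T, fun x => by rw [hT, Complex.ofReal_re]; positivity,
    fun x => by rw [hT]; exact Complex.ofReal_im _⟩ x = ‖F x‖ ^ 2 := by
    simp only [quad, hT, Complex.ofReal_re]
  rw [h0]
  have h1 : ‖F x‖ = Metric.infDist (ι (L x)) (K.map ι.toLinearMap : Set _) := by
    rw [← Metric.infDist_closure, ← Submodule.topologicalClosure_coe]
    change ‖ι (L x) - M.starProjection (ι (L x))‖ = _
    rw [Submodule.starProjection_minimal, Metric.infDist_eq_iInf]
    simp only [dist_eq_norm]
    rfl
  have hbdd : BddBelow (Set.range fun k : K => ‖L x - k‖) :=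
    ⟨0, by rintro _ ⟨k, rfl⟩; exact norm_nonneg _⟩
  have hbdd2 : BddBelow (Set.range fun k : K => ‖L x - k‖ ^ 2) :=
    ⟨0, by rintro _ ⟨k, rfl⟩; positivity⟩
  have h2 : ‖F x‖ = ⨅ k : K, ‖L x - k‖ := by
    have hd : ∀ k : E, dist (ι (L x)) (ι k) = ‖L x - k‖ := fun k => by
      rw [dist_eq_norm, ← map_sub]
      exact UniformSpace.Completion.norm_coe _
    rw [h1]
    have hne : (K.map ι.toLinearMap : Set (UniformSpace.Completion E)).Nonempty :=
      ⟨0, Submodule.zero_mem _⟩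
    apply le_antisymm
    · refine le_ciInf fun k => ?_
      rw [← hd]
      exact Metric.infDist_le_dist_of_mem (Submodule.mem_map_of_mem k.2)
    · refine (Metric.le_infDist hne).2 ?_
      rintro _ ⟨k, hk, rfl⟩
      exact (ciInf_le hbdd ⟨k, hk⟩).trans (hd k).ge
  rw [h2]
  apply le_antisymm
  · refine le_ciInf fun k => ?_
    have hk := ciInf_le hbdd k
    have h0 : 0 ≤ ⨅ k : K, ‖L x - k‖ := Real.iInf_nonneg fun k => norm_nonneg _
    exact pow_le_pow_left₀ h0 hk 2
  · have hs : 0 ≤ ⨅ k : K, ‖L x - k‖ ^ 2 := Real.iInf_nonneg fun k => by positivity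
    have : √(⨅ k : K, ‖L x - k‖ ^ 2) ≤ ⨅ k : K, ‖L x - k‖ :=
      le_ciInf fun k => Real.sqrt_le_iff.2 ⟨norm_nonneg _, ciInf_le hbdd2 k⟩
    calc _ = √(⨅ k : K, ‖L x - k‖ ^ 2) ^ 2 := (Real.sq_sqrt hs).symm
      _ ≤ _ := pow_le_pow_left₀ (Real.sqrt_nonneg _) this 2

theorem conj_symm (t : NonnegForm X) (x y : X) :
    (starRingEnd ℂ) (t.toLin x y) = t.toLin y x := by
  have h1 : t.quad (y + x) = t.quad (x + y) := by rw [add_comm]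
  have h2 : t.quad (y - x) = t.quad (x - y) := by
    simp [quad]; ring
  have h3 : t.quad (y + Complex.I • x) = t.quad (x - Complex.I • y) := by
    simp [quad]; ring
  have h4 : t.quad (y - Complex.I • x) = t.quad (x + Complex.I • y) := by
    simp [quad]; ring
  rw [polarization t x y, polarization t y x, h1, h2, h3, h4]
  apply Complex.ext 
  · simp
  · simp; ring

/-- The infimum that defines the parallel sum is the quadratic form of a nonnegative form. -/
theorem exists_parallelSum (t w : NonnegForm X) :
    ∃ s : NonnegForm X, ∀ x, s.quad x = ⨅ y : X, (t.quad (x - y) + w.quad y) := by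
  let core : PreInnerProductSpace.Core ℂ (X × X) :=
    { inner := fun a b => t.toLin b.1 a.1 + w.toLin b.2 a.2
      conj_inner_symm := fun a b => by simp [conj_symm]
      re_inner_nonneg := fun a => by
        simpa using add_nonneg (t.re_nonneg a.1) (w.re_nonneg a.2)
      add_left := fun a b c => by simp; ring
      smul_left := fun a b r => by simp; ring }
  let _ : SeminormedAddCommGroup (X × X) :=
    InnerProductSpace.Core.toSeminormedAddCommGroup (𝕜 := ℂ) (c := core)
  let _ : InnerProductSpace ℂ (X × X) := InnerProductSpace.ofCore core
  have hn : ∀ a : X × X, ‖a‖ ^ 2 = t.quad a.1 + w.quad a.2 := fun a => by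
    rw [← inner_self_eq_norm_sq (𝕜 := ℂ)]
    rfl
  let D : X →ₗ[ℂ] X × X := LinearMap.prod LinearMap.id (-LinearMap.id)
  obtain ⟨s, hs⟩ := exists_quad_eq_iInf_norm (LinearMap.inl ℂ X X) (LinearMap.range D)
  refine ⟨s, fun x => ?_⟩
  rw [hs]
  refine (Function.Surjective.iInf_congr (fun y : X => (⟨D y, y, rfl⟩ : LinearMap.range D))
    ?_ fun y => ?_).symm
  · rintro ⟨_, y, rfl⟩
    exact ⟨y, rfl⟩
  · rw [hn]
    simp [D]

/-- The parallel sum `t : w`: the form whose quadratic form is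
`(t : w)[x] = inf_y (t[x - y] + w[y])`. -/
noncomputable def parallelSum (t w : NonnegForm X) : NonnegForm X :=
  (exists_parallelSum t w).choose

theorem quad_parallelSum (t w : NonnegForm X) (x : X) :
    (parallelSum t w).quad x = ⨅ y : X, (t.quad (x - y) + w.quad y) :=
  (exists_parallelSum t w).choose_spec x

theorem parallelSum_bddBelow (t w : NonnegForm X) (x : X) :
    BddBelow (Set.range fun y : X => t.quad (x - y) + w.quad y) :=
  ⟨0, by rintro _ ⟨y, rfl⟩; exact add_nonneg (t.quad_nonneg _) (w.quad_nonneg _)⟩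

theorem parallelSum_nsmul_le (t w : NonnegForm X) (n : ℕ) : parallelSum t (n • w) ≤ t := by
  intro x
  rw [quad_parallelSum]
  refine (ciInf_le (parallelSum_bddBelow t (n • w) x) 0).trans ?_
  simp [quad]

theorem parallelSum_nsmul_mono (t w : NonnegForm X) :
    Monotone fun n : ℕ => parallelSum t (n • w) := by
  intro m n hmn x
  simp only [quad_parallelSum]
  refine ciInf_mono (parallelSum_bddBelow t (m • w) x) fun y => ?_
  have := w.quad_nonneg y
  simp only [quad_nsmul]
  gcongr

/-- A bounded increasing sequence of forms has a pointwise supremum that is a form. -/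
theorem exists_iSup (s : ℕ → NonnegForm X) (t : NonnegForm X) (hs : Monotone s)
    (ht : ∀ n, s n ≤ t) : ∃ d : NonnegForm X, ∀ x, d.quad x = ⨆ n, (s n).quad x := by
  have hq : ∀ x, Filter.Tendsto (fun n => (s n).quad x) Filter.atTop
      (nhds (⨆ n, (s n).quad x)) := fun x =>
    tendsto_atTop_ciSup (fun m n h => hs h x) ⟨t.quad x, by rintro _ ⟨n, rfl⟩; exact ht n x⟩
  have hl : ∀ x y, ∃ z, Filter.Tendsto (fun n => (s n).toLin x y) Filter.atTop (nhds z) := by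
    intro x y
    have hc : ∀ x, Filter.Tendsto (fun n => ((s n).quad x : ℂ)) Filter.atTop
        (nhds ((⨆ n, (s n).quad x : ℝ) : ℂ)) := fun x =>
      (Complex.continuous_ofReal.tendsto _).comp (hq x)
    simp only [fun n => polarization (s n) x y]
    exact ⟨_, ((((hc _).sub (hc _)).add ((hc _).const_mul _)).sub ((hc _).const_mul _)).const_mul _⟩
  choose B hB using hl
  let T : X →ₗ[ℂ] X →ₗ⋆[ℂ] ℂ := LinearMap.mk₂'ₛₗ (RingHom.id ℂ) (starRingEnd ℂ) B
    (fun x x' y => tendsto_nhds_unique (hB _ _) (by simpa using (hB x y).add (hB x' y)))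
    (fun c x y => tendsto_nhds_unique (hB _ _) (by simpa using (hB x y).const_mul c))
    (fun x y y' => tendsto_nhds_unique (hB _ _) (by simpa using (hB x y).add (hB x y')))
    (fun c x y => tendsto_nhds_unique (hB _ _)
      (by simpa using (hB x y).const_mul ((starRingEnd ℂ) c)))
  have hT : ∀ x, T x x = ((⨆ n, (s n).quad x : ℝ) : ℂ) := fun x =>
    tendsto_nhds_unique (hB x x) (by
      simp only [toLin_self]
      exact (Complex.continuous_ofReal.tendsto _).comp (hq x))
  refine ⟨⟨T, fun x => ?_, fun x => ?_⟩, fun x => ?_⟩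
  · rw [hT, Complex.ofReal_re]
    exact Real.iSup_nonneg fun n => (s n).quad_nonneg x
  · rw [hT, Complex.ofReal_im]
  · simp only [quad, hT, Complex.ofReal_re]

/-- The form `D_w t = sup_n (t : n w)`, the `w`-almost dominated part of `t`. -/
noncomputable def almostDominatedPart (w t : NonnegForm X) : NonnegForm X :=
  (exists_iSup (fun n : ℕ => parallelSum t (n • w)) t (parallelSum_nsmul_mono t w)
    (parallelSum_nsmul_le t w)).choose

theorem quad_almostDominatedPart (w t : NonnegForm X) (x : X) :
    (almostDominatedPart w t).quad x = ⨆ n : ℕ, (parallelSum t (n • w)).quad x :=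
  (exists_iSup (fun n : ℕ => parallelSum t (n • w)) t (parallelSum_nsmul_mono t w)
    (parallelSum_nsmul_le t w)).choose_spec x

/-- The set of `t`-quasi-units: the forms `w` in the interval `[0, t]` with `D_w t = w`. -/
def quasiUnits (t : NonnegForm X) : Set (NonnegForm X) :=
  {w | w ≤ t ∧ almostDominatedPart w t = w}

end NonnegForm

/-! Write `t[x] = ‖J x‖ ^ 2` with `J` of dense range in a Hilbert space `H`. A form `w ≤ t` is then
`‖A (J x)‖ ^ 2` for a bounded operator `A` on `H`. In `t : (n w)` the term `n * ‖A h‖ ^ 2` becomes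
an ever stronger penalty, so in the limit `D_w t[x]` is the squared distance from `J x` to `ker A`,
that is `‖P (J x)‖ ^ 2` with `P` the projection onto `(ker A)ᗮ` (`quad_almostDominatedPart_eq`).
Hence the quasi-units are exactly the forms `‖P (J x)‖ ^ 2` with `P` an orthogonal projection
(`exists_eq_projectionForm`, `projectionForm_mem_quasiUnits`), and their order is inclusion of
ranges (`projectionForm_le_projectionForm_iff`). The closed subspaces of `H` form a lattice. -/

namespace NonnegForm

universe u

variable {X : Type*} [AddCommGroup X] [Module ℂ X]

/-! ### Forms and Hilbert spaces -/

section

variable {H : Type*} [NormedAddCommGroup H] [InnerProductSpace ℂ H]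

/-- The form `x ↦ ‖F x‖ ^ 2` induced by a linear map into an inner product space. -/
noncomputable def ofLinearMap (F : X →ₗ[ℂ] H) : NonnegForm X where
  toLin := LinearMap.mk₂'ₛₗ (RingHom.id ℂ) (starRingEnd ℂ)
    (fun x y => inner ℂ (F y) (F x))
    (fun x x' y => by simp) (fun c x y => by simp)
    (fun x y y' => by simp) (fun c x y => by simp [mul_comm])
  re_nonneg x := by
    simpa using inner_self_nonneg (𝕜 := ℂ) (x := F x)
  im_eq_zero x := by
    simpa using inner_self_im (𝕜 := ℂ) (F x)

theorem quad_ofLinearMap (F : X →ₗ[ℂ] H) (x : X) : (ofLinearMap F).quad x = ‖F x‖ ^ 2 := by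
  rw [← inner_self_eq_norm_sq (𝕜 := ℂ)]
  rfl

end

/-- Every nonnegative form comes from a linear map with dense range into a Hilbert space. -/
theorem exists_hilbert_representation {X : Type u} [AddCommGroup X] [Module ℂ X]
    (t : NonnegForm X) :
    ∃ (H : Type u) (_ : NormedAddCommGroup H) (_ : InnerProductSpace ℂ H) (_ : CompleteSpace H)
      (J : X →ₗ[ℂ] H), DenseRange J ∧ ∀ x, t.quad x = ‖J x‖ ^ 2 := by
  let core : PreInnerProductSpace.Core ℂ X :=
    { inner := fun a b => t.toLin b a
      conj_inner_symm := fun a b => by simp [conj_symm]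
      re_inner_nonneg := fun a => by simpa using t.re_nonneg a
      add_left := fun a b c => by simp
      smul_left := fun a b r => by simp }
  let _ : SeminormedAddCommGroup X :=
    InnerProductSpace.Core.toSeminormedAddCommGroup (𝕜 := ℂ) (c := core)
  let _ : InnerProductSpace ℂ X := InnerProductSpace.ofCore core
  refine ⟨UniformSpace.Completion X, inferInstance, inferInstance, inferInstance,
    (UniformSpace.Completion.toComplL (𝕜 := ℂ) (E := X)).toLinearMap,
    UniformSpace.Completion.denseRange_coe, fun x => ?_⟩
  change _ = ‖(x : UniformSpace.Completion X)‖ ^ 2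
  rw [UniformSpace.Completion.norm_coe, ← inner_self_eq_norm_sq (𝕜 := ℂ)]
  rfl

/-! ### The almost dominated part as a projection -/

section

variable {H G : Type*} [NormedAddCommGroup H] [InnerProductSpace ℂ H]
  [NormedAddCommGroup G] [InnerProductSpace ℂ G]

/-- If `w[x] = r * ‖A (J x)‖ ^ 2`, then the infimum defining `t : w` may be taken over the whole
Hilbert space. -/
theorem le_quad_parallelSum_and_quad_parallelSum_le {t w : NonnegForm X} {J : X →ₗ[ℂ] H}
    (hJ : DenseRange J) (ht : ∀ x, t.quad x = ‖J x‖ ^ 2) (A : H →L[ℂ] G) {r : ℝ}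
    (hw : ∀ x, w.quad x = r * ‖A (J x)‖ ^ 2) (x : X) :
    (∀ c, (∀ h, c ≤ ‖J x - h‖ ^ 2 + r * ‖A h‖ ^ 2) → c ≤ (parallelSum t w).quad x) ∧
    ∀ h, (parallelSum t w).quad x ≤ ‖J x - h‖ ^ 2 + r * ‖A h‖ ^ 2 := by
  have key : ∀ y, t.quad (x - y) + w.quad y = ‖J x - J y‖ ^ 2 + r * ‖A (J y)‖ ^ 2 :=
    fun y => by rw [ht, hw, map_sub]
  rw [quad_parallelSum]
  refine ⟨fun c hc => le_ciInf fun y => (hc (J y)).trans (key y).ge, fun h => ?_⟩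
  refine hJ.induction_on h (isClosed_le (by fun_prop) (by fun_prop)) fun y => ?_
  exact (ciInf_le (parallelSum_bddBelow t w x) y).trans (key y).le

theorem two_mul_re_inner_sub_le (a b : H) : 2 * (inner ℂ a b : ℂ).re - ‖b‖ ^ 2 ≤ ‖a‖ ^ 2 := by
  have h := norm_sub_sq (𝕜 := ℂ) a b
  have h0 := sq_nonneg ‖a - b‖
  simp only [RCLike.re_to_complex] at h
  linarith

variable [CompleteSpace H] [CompleteSpace G]

/-- If `w[x] = ‖A (J x)‖ ^ 2`, then `D_w t` is given by the projection onto `(ker A)ᗮ`. -/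
theorem quad_almostDominatedPart_eq {t w : NonnegForm X} {J : X →ₗ[ℂ] H}
    (hJ : DenseRange J) (ht : ∀ x, t.quad x = ‖J x‖ ^ 2) (A : H →L[ℂ] G)
    (hw : ∀ x, w.quad x = ‖A (J x)‖ ^ 2) (x : X) :
    (almostDominatedPart w t).quad x = ‖(A.ker)ᗮ.starProjection (J x)‖ ^ 2 := by
  have hn : ∀ n : ℕ, ∀ y, (n • w).quad y = n * ‖A (J y)‖ ^ 2 := fun n y => by
    rw [quad_nsmul, hw]
  set u := J x
  -- The test vector `u - P u` lies in `ker A`, so its penalty vanishes for every `n`.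
  have hup : ∀ n : ℕ, (parallelSum t (n • w)).quad x ≤ ‖(A.ker)ᗮ.starProjection u‖ ^ 2 := by
    intro n
    have hmem : u - (A.ker)ᗮ.starProjection u ∈ A.ker := by
      have := (A.ker)ᗮ.sub_starProjection_mem_orthogonal u
      rwa [Submodule.orthogonal_orthogonal_eq_closure,
        IsClosed.submodule_topologicalClosure_eq A.isClosed_ker] at this
    have h := (le_quad_parallelSum_and_quad_parallelSum_le hJ ht A (hn n) x).2
      (u - (A.ker)ᗮ.starProjection u)
    have h0 : A (u - (A.ker)ᗮ.starProjection u) = 0 := hmem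
    rw [h0] at h
    simpa [u] using h
  have hbdd : BddAbove (Set.range fun n : ℕ => (parallelSum t (n • w)).quad x) :=
    ⟨_, by rintro _ ⟨n, rfl⟩; exact hup n⟩
  rw [quad_almostDominatedPart]
  refine le_antisymm (ciSup_le hup) ?_
  set S := ⨆ n : ℕ, (parallelSum t (n • w)).quad x
  -- Duality: bound `‖u - h‖ ^ 2` from below using `A.adjoint g`, and `n * ‖A h‖ ^ 2` using `g`. The
  -- terms containing `h` cancel in the sum, at the cost of `‖g‖ ^ 2 / n`, which tends to `0`.
  have hlow : ∀ g : G, 2 * (inner ℂ u (A.adjoint g) : ℂ).re - ‖A.adjoint g‖ ^ 2 ≤ S := by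
    intro g
    have hlim : Filter.Tendsto (fun n : ℕ => 2 * (inner ℂ u (A.adjoint g) : ℂ).re
        - ‖A.adjoint g‖ ^ 2 - ‖g‖ ^ 2 / n) Filter.atTop
        (nhds (2 * (inner ℂ u (A.adjoint g) : ℂ).re - ‖A.adjoint g‖ ^ 2 - 0)) :=
      tendsto_const_nhds.sub (tendsto_const_div_atTop_nhds_zero_nat _)
    rw [sub_zero] at hlim
    refine le_of_tendsto hlim ((Filter.eventually_gt_atTop 0).mono fun n hn0 => ?_)
    refine le_trans ?_ (le_ciSup hbdd n)
    refine (le_quad_parallelSum_and_quad_parallelSum_le hJ ht A (hn n) x).1 _ fun h => ?_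
    have hpos : (0 : ℝ) < n := Nat.cast_pos.2 hn0
    have h1 := two_mul_re_inner_sub_le (u - h) (A.adjoint g)
    have h2 := two_mul_re_inner_sub_le ((n : ℂ) • A h) g
    have h3 : n * ‖A h‖ ^ 2 = ‖(n : ℂ) • A h‖ ^ 2 / n := by
      rw [norm_smul, Complex.norm_natCast]
      field_simp
    have h4 : 2 * (inner ℂ (A h) g : ℂ).re - ‖g‖ ^ 2 / n ≤ n * ‖A h‖ ^ 2 := by
      rw [h3, le_div_iff₀ hpos]
      refine le_trans (le_of_eq ?_) h2
      rw [inner_smul_left, Complex.conj_natCast, ← Complex.ofReal_natCast, Complex.re_ofReal_mul]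
      field_simp
    rw [inner_sub_left, ContinuousLinearMap.adjoint_inner_right A h, Complex.sub_re] at h1
    linarith
  -- The range of the adjoint is dense in `(A.ker)ᗮ`, so the bound extends by continuity; at `v = P
  -- u` it reads `‖P u‖ ^ 2 ≤ S`.
  have hcl : ∀ v ∈ (A.ker)ᗮ, 2 * (inner ℂ u v : ℂ).re - ‖v‖ ^ 2 ≤ S := by
    intro v hv
    rw [ContinuousLinearMap.orthogonal_ker] at hv
    have hclosed : IsClosed {v : H | 2 * (inner ℂ u v : ℂ).re - ‖v‖ ^ 2 ≤ S} :=
      isClosed_le (by fun_prop) (by fun_prop)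
    refine closure_minimal ?_ hclosed hv
    rintro _ ⟨g, rfl⟩
    exact hlow g
  refine le_trans (le_of_eq ?_) (hcl _ ((A.ker)ᗮ.starProjection_apply_mem u))
  have h5 := (A.ker)ᗮ.re_inner_starProjection_eq_normSq u
  rw [← inner_conj_symm, Complex.conj_re]
  have h6 : ‖(A.ker)ᗮ.starProjection u‖ = ‖(A.ker)ᗮ.orthogonalProjectionOnto u‖ := rfl
  simp only [RCLike.re_to_complex, ← h6] at h5
  linarith

/-- The form `x ↦ ‖P (J x)‖ ^ 2`, where `P` is the orthogonal projection onto `Nᗮ`. -/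
noncomputable def projectionForm (J : X →ₗ[ℂ] H) (N : Submodule ℂ H) : NonnegForm X :=
  ofLinearMap (Nᗮ.starProjection.toLinearMap ∘ₗ J)

theorem quad_projectionForm (J : X →ₗ[ℂ] H) (N : Submodule ℂ H) (x : X) :
    (projectionForm J N).quad x = ‖Nᗮ.starProjection (J x)‖ ^ 2 :=
  quad_ofLinearMap _ x

/-- By density the inequality of forms holds on all of `H`. A vector of `Mᗮ` then keeps its full
norm when projected to `Nᗮ`, which forces it to lie there. Conversely, projecting onto the smaller
subspace factors through the larger. -/
theorem projectionForm_le_projectionForm_iff {J : X →ₗ[ℂ] H} (hJ : DenseRange J)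
    {M N : Submodule ℂ H} : projectionForm J M ≤ projectionForm J N ↔ Mᗮ ≤ Nᗮ := by
  constructor
  · intro hle h hh
    have hall : ∀ h, ‖Mᗮ.starProjection h‖ ≤ ‖Nᗮ.starProjection h‖ := fun h =>
      hJ.induction_on h (isClosed_le (by fun_prop) (by fun_prop)) fun x => by
        have := hle x
        rw [quad_projectionForm, quad_projectionForm] at this
        exact le_of_sq_le_sq this (norm_nonneg _)
    have h1 := hall h
    rw [Submodule.starProjection_eq_self_iff.2 hh] at h1
    exact (Submodule.mem_iff_norm_starProjection _ _).2
      (le_antisymm (Submodule.norm_starProjection_apply_le _ _) h1)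
  · intro hle x
    rw [quad_projectionForm, quad_projectionForm]
    have h1 : Mᗮ.starProjection (Nᗮ.starProjection (J x)) = Mᗮ.starProjection (J x) :=
      DFunLike.congr_fun (Submodule.starProjection_comp_starProjection_of_le hle) (J x)
    rw [← h1]
    exact pow_le_pow_left₀ (norm_nonneg _) (Submodule.norm_starProjection_apply_le _ _) 2

/-- Here `A` is the projection itself: its kernel is `Nᗮᗮ`, whose orthogonal complement is `Nᗮ`
again. -/
theorem projectionForm_mem_quasiUnits {t : NonnegForm X} {J : X →ₗ[ℂ] H} (hJ : DenseRange J)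
    (ht : ∀ x, t.quad x = ‖J x‖ ^ 2) (N : Submodule ℂ H) :
    projectionForm J N ∈ quasiUnits t := by
  refine ⟨fun x => ?_, ext_quad fun x => ?_⟩
  · rw [quad_projectionForm, ht]
    exact pow_le_pow_left₀ (norm_nonneg _) (Submodule.norm_starProjection_apply_le _ _) 2
  · rw [quad_almostDominatedPart_eq hJ ht Nᗮ.starProjection (quad_projectionForm J N),
      quad_projectionForm]
    simp only [Submodule.ker_starProjection, Submodule.triorthogonal_eq_orthogonal]

end

/-- The quasi-units of `t` are exactly given by orthogonal projections. -/
theorem exists_eq_projectionForm {X : Type u} [AddCommGroup X] [Module ℂ X] {H : Type*}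
    [NormedAddCommGroup H] [InnerProductSpace ℂ H] [CompleteSpace H] {t w : NonnegForm X}
    {J : X →ₗ[ℂ] H} (hJ : DenseRange J) (ht : ∀ x, t.quad x = ‖J x‖ ^ 2)
    (hw : w ∈ quasiUnits t) : ∃ N : Submodule ℂ H, w = projectionForm J N := by
  obtain ⟨G, _, _, _, F, -, hF⟩ := exists_hilbert_representation w
  -- Since `w ≤ t`, the map `F` factors through `J` as a contraction, which extends to all of `H`.
  have hbound : ∃ C : ℝ, ∀ x, ‖F x‖ ≤ C * ‖J x‖ := by
    refine ⟨1, fun x => ?_⟩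
    rw [one_mul]
    refine le_of_sq_le_sq ?_ (norm_nonneg _)
    rw [← hF, ← ht]
    exact hw.1 x
  have hA : ∀ x, w.quad x = ‖F.extendOfNorm J (J x)‖ ^ 2 := fun x => by
    rw [LinearMap.extendOfNorm_eq hJ hbound, hF]
  refine ⟨(F.extendOfNorm J).ker, ext_quad fun x => ?_⟩
  rw [quad_projectionForm, ← quad_almostDominatedPart_eq hJ ht _ hA, hw.2]

end NonnegForm

theorem mainTheorem10 {X : Type*} [AddCommGroup X] [Module ℂ X] (t : NonnegForm X) :
    ∀ v w : NonnegForm.quasiUnits t,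
      (∃ m : NonnegForm.quasiUnits t, IsGLB {v, w} m) ∧
      (∃ j : NonnegForm.quasiUnits t, IsLUB {v, w} j) := by
  rintro ⟨v, hv⟩ ⟨w, hw⟩
  obtain ⟨H, _, _, _, J, hJ, ht⟩ := t.exists_hilbert_representation
  obtain ⟨M, rfl⟩ := NonnegForm.exists_eq_projectionForm hJ ht hv
  obtain ⟨N, rfl⟩ := NonnegForm.exists_eq_projectionForm hJ ht hw
  have hle := fun K L : Submodule ℂ H =>
    NonnegForm.projectionForm_le_projectionForm_iff (M := K) (N := L) hJ
  refine ⟨⟨⟨_, NonnegForm.projectionForm_mem_quasiUnits hJ ht (M ⊔ N)⟩, ?_, ?_⟩,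
    ⟨⟨_, NonnegForm.projectionForm_mem_quasiUnits hJ ht (Mᗮ ⊔ Nᗮ)ᗮ⟩, ?_, ?_⟩⟩
  · rintro _ (rfl | rfl)
    · exact (hle _ _).2 (Submodule.orthogonal_le le_sup_left)
    · exact (hle _ _).2 (Submodule.orthogonal_le le_sup_right)
  · rintro ⟨s, hs⟩ hlow
    obtain ⟨K, rfl⟩ := NonnegForm.exists_eq_projectionForm hJ ht hs
    refine (hle _ _).2 ?_
    rw [← Submodule.inf_orthogonal]
    exact le_inf ((hle _ _).1 (hlow (Or.inl rfl))) ((hle _ _).1 (hlow (Or.inr rfl)))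
  · rintro _ (rfl | rfl)
    · exact (hle _ _).2 (le_sup_left.trans (Submodule.le_orthogonal_orthogonal _))
    · exact (hle _ _).2 (le_sup_right.trans (Submodule.le_orthogonal_orthogonal _))
  · rintro ⟨s, hs⟩ hup
    obtain ⟨K, rfl⟩ := NonnegForm.exists_eq_projectionForm hJ ht hs
    refine (hle _ _).2 ?_
    -- `Kᗮ` is closed, so containing `Mᗮ ⊔ Nᗮ` it also contains its double complement.
    rw [← Submodule.triorthogonal_eq_orthogonal (K := K)]
    refine Submodule.orthogonal_le (Submodule.orthogonal_le ?_)
    exact sup_le ((hle _ _).1 (hup (Or.inl rfl))) ((hle _ _).1 (hup (Or.inr rfl)))
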